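/- **Notation.** For $A\in\mathbb R^{n\times n}$ let $\Xi(A)=\bigl(\sum_{i\ne j}|A(i,j)|^2\bigr)^{1/2}$. An LU factorization with partial pivoting (LUPP) of $M\in\mathbb R^{m\times k}$ is $M=P^TLU$ with $P$ a permutation matrix, $L\in\mathbb R^{m\times k}$ unit lower trapezoidal with $|L_{ij}|\le 1$ for $i>j$, and $U\in\mathbb R^{k\times k}$ upper triangular. **The algorithm (recursive Jacobi).** Fix a block-size rule $b=b(m)$ (for example $b=m^f$ with a fixed $0<f<1$), a threshold $n_{\rm threshold}\in\mathbb N$, and positive tolerances $\tau$ for the recursive calls, where $\tau$ may depend on the matrix that a call receives. Called on a symmetric $A\in\mathbb R^{n\times n}$, with $b=b(n)$: * *Base case*, if $n<n_{\rm threshold}$ or $2b\ge n$: return $(Q,D)$ for some eigendecomposition $A=QDQ^T$ with $Q$ orthogonal and $D$ diagonal. * *Otherwise* partition $A$ into $b\times b$ blocks, set $Q=I$, and repeat sweeps. One sweep runs through the block pairs $I<J$ in the column-cyclic order $(1,2),(1,3),(2,3),(1,4),(2,4),(3,4),\dots$ For each pair, let $\hat A=A([I,J],[I,J])$ be the $2b\times2b$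 submatrix of $A$ in block rows and columns $I$ and $J$. Call recursive Jacobi on $\hat A$ to obtain $\hat Q$. Compute an LUPP $\hat Q_1^T=P^TLU$, where $\hat Q_1$ consists of the first $b$ rows of $\hat Q$, and replace $\hat Q$ by $\hat QP^T$. Then multiply block rows $I,J$ of $A$ by $\hat Q^T$, block columns $I,J$ of $A$ by $\hat Q$, and block columns $I,J$ of $Q$ by $\hat Q$. A pair may be skipped only if $\hat A$ is already diagonal. A recursive call stops, and returns its current $(Q,A)$, after the first sweep at whose end all off-diagonal entries of its current matrix are at most $\tau$ in absolute value. Choices that are left open (the eigendecompositions in the base case, ties between pivots, skipping a pair with diagonal $\hat A$) may be made in any way. **Statement.** Assume that the block partitions exist: at the size $n$ and at every size reached from it by the recursion $m\mapsto 2b(m)$, either the base case holds or $b(m)$ is positive and divides $m$. Then recursive Jacobi converges for every symmetric $A\in\mathbb R^{n\times n}$: 1. the call on $A$ can be carried out and returns; 2. if $n$ is in the base case, every matrix $D$ returned satisfies $\Xi(D)=0$; 3. otherwise, after any finite number of sweeps a further sweep can be carried out (with its recursive calls returning), and for every infinite sequence of sweeps started at $A$, the current matrix $A^{(s)}$ after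 $s$ sweeps satisfies $\Xi(A^{(s)})\to0$ as $s\to\infty$. -/

import Mathlib

open Filter Topology

namespace RecJacobi

/-- The off-diagonal norm `Ξ(A)`: the square root of the sum of `|A i j|²` over all `i ≠ j`. -/
noncomputable def offNorm {m : ℕ} (A : Matrix (Fin m) (Fin m) ℝ) : ℝ :=
  Real.sqrt (∑ i, ∑ j ∈ Finset.univ.erase i, |A i j| ^ 2)

/-- All off-diagonal entries of `A` are at most `τ` in absolute value. -/
def OffEntriesLE {m : ℕ} (τ : ℝ) (A : Matrix (Fin m) (Fin m) ℝ) : Prop :=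
  ∀ i j, i ≠ j → |A i j| ≤ τ

/-- `A = Q D Qᵀ` with `Q` orthogonal and `D` diagonal: the result of a direct solve. -/
def IsEigendecomposition {m : ℕ} (A Q D : Matrix (Fin m) (Fin m) ℝ) : Prop :=
  Q.transpose * Q = 1 ∧ D.IsDiag ∧ A = Q * D * Q.transpose

/-- `M = Pᵀ L U` is an LU factorization with partial pivoting: `P` is the matrix of the permutation
`σ`, `L` is unit lower trapezoidal with entries at most one in absolute value (every pivot is an
entry of largest absolute value in its column of the current Schur complement), and `U` is upper
triangular. Ties between pivots may be broken in any way. -/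
def IsLUPP {m k : ℕ} (M : Matrix (Fin m) (Fin k) ℝ) (σ : Equiv.Perm (Fin m))
    (L : Matrix (Fin m) (Fin k) ℝ) (U : Matrix (Fin k) (Fin k) ℝ) : Prop :=
  M = (σ.permMatrix ℝ).transpose * L * U ∧
  (∀ (i : Fin m) (j : Fin k), (i : ℕ) < (j : ℕ) → L i j = 0) ∧
  (∀ (i : Fin m) (j : Fin k), (i : ℕ) = (j : ℕ) → L i j = 1) ∧
  (∀ (i : Fin m) (j : Fin k), (j : ℕ) < (i : ℕ) → |L i j| ≤ 1) ∧
  (∀ i j, j < i → U i j = 0)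

/-- The index `I * b + i` of the `i`-th row of block `I`, for blocks of size `b` (zero-based). -/
def blockIdx (n b : ℕ) (I : Fin (n / b)) (i : Fin b) : Fin n :=
  ⟨(I : ℕ) * b + i, by
    have h1 : ((I : ℕ) + 1) * b ≤ n / b * b := Nat.mul_le_mul_right b I.isLt
    have h2 : n / b * b ≤ n := Nat.div_mul_le_self n b
    have h3 : ((I : ℕ) + 1) * b = (I : ℕ) * b + b := Nat.succ_mul _ _
    have h4 := i.isLt
    omega⟩

/-- The rows of block `I` followed by those of block `J`: the index list `[I, J]`. -/
def pairIdx (n b : ℕ) (I J : Fin (n / b)) : Fin (b + b) → Fin n :=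
  Fin.addCases (blockIdx n b I) (blockIdx n b J)

/-- For an injective index list `e`, the `n × n` matrix that has `R` in the rows and columns listed
by `e` and agrees with the identity elsewhere. Multiplying by it on the right multiplies the
columns listed by `e` by `R`; multiplying by its transpose on the left multiplies the rows listed
by `e` by `Rᵀ`. -/
def embed {n k : ℕ} (e : Fin k → Fin n) (R : Matrix (Fin k) (Fin k) ℝ) :
    Matrix (Fin n) (Fin n) ℝ :=
  1 + (1 : Matrix (Fin n) (Fin n) ℝ).submatrix id e * (R - 1) *
    (1 : Matrix (Fin n) (Fin n) ℝ).submatrix e id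

/-- The column-cyclic ordering of the pairs `I < J` of block indices:
`(0,1), (0,2), (1,2), (0,3), (1,3), (2,3), …`. -/
def columnCyclic (p : ℕ) : List (Fin p × Fin p) :=
  (List.finRange p).flatMap fun J =>
    ((List.finRange p).filter fun I => I < J).map fun I => (I, J)

/-- A state `(Q, A)` of the iteration. -/
abbrev State (n : ℕ) : Type := Matrix (Fin n) (Fin n) ℝ × Matrix (Fin n) (Fin n) ℝ

/-- One step of the inner loop on the block pair `(I, J)`, with block size `b`; `Sub Â Q̂ D̂` says
that the recursive call on the `2b × 2b` submatrix `Â` may return `(Q̂, D̂)`. The step always runs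
the recursive call, followed by the pivoting step `Q̂ ← Q̂ Pᵀ`, and updates `A ← Gᵀ A G` and
`Q ← Q G` for `G` the embedding of the pivoted `Q̂`; it may be skipped only if `Â` is already
diagonal. -/
def BlockStep {n : ℕ} (b : ℕ)
    (Sub : Matrix (Fin (b + b)) (Fin (b + b)) ℝ → Matrix (Fin (b + b)) (Fin (b + b)) ℝ →
      Matrix (Fin (b + b)) (Fin (b + b)) ℝ → Prop)
    (IJ : Fin (n / b) × Fin (n / b)) (S T : State n) : Prop :=
  ((S.2.submatrix (pairIdx n b IJ.1 IJ.2) (pairIdx n b IJ.1 IJ.2)).IsDiag ∧ T = S) ∨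
  ∃ (Qh Dh : Matrix (Fin (b + b)) (Fin (b + b)) ℝ) (σ : Equiv.Perm (Fin (b + b)))
    (L : Matrix (Fin (b + b)) (Fin b) ℝ) (U : Matrix (Fin b) (Fin b) ℝ)
    (G : Matrix (Fin n) (Fin n) ℝ),
    Sub (S.2.submatrix (pairIdx n b IJ.1 IJ.2) (pairIdx n b IJ.1 IJ.2)) Qh Dh ∧
    IsLUPP (Qh.submatrix (Fin.castAdd b) id).transpose σ L U ∧
    G = embed (pairIdx n b IJ.1 IJ.2) (Qh * (σ.permMatrix ℝ).transpose) ∧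
    T = (S.1 * G, G.transpose * S.2 * G)

/-- Block steps on the pairs of a list, one after the other. -/
def BlockSteps {n : ℕ} (b : ℕ)
    (Sub : Matrix (Fin (b + b)) (Fin (b + b)) ℝ → Matrix (Fin (b + b)) (Fin (b + b)) ℝ →
      Matrix (Fin (b + b)) (Fin (b + b)) ℝ → Prop) :
    List (Fin (n / b) × Fin (n / b)) → State n → State n → Prop
  | [], S, T => T = S
  | IJ :: l, S, T => ∃ S', BlockStep b Sub IJ S S' ∧ BlockSteps b Sub l S' T

/-- The parameters of the algorithm: the block size `b` used on matrices of size `m` (for instance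
`b = m ^ f` with a fixed log block size `f`), the size below which one solves directly, and the
tolerance of the stopping test of a recursive call, which may depend on the matrix that the call
was given. -/
structure Params where
  /-- block size used on matrices of a given size -/
  blockSize : ℕ → ℕ
  /-- matrices of smaller size are diagonalized directly -/
  threshold : ℕ
  /-- a call on `B` stops once all off-diagonal entries are at most `tol m B` -/
  tol : (m : ℕ) → Matrix (Fin m) (Fin m) ℝ → ℝ

/-- The base case of the recursion: `n` is below the threshold, or `2b ≥ n`. -/
abbrev Params.IsBase (P : Params) (n : ℕ) : Prop :=
  n < P.threshold ∨ n ≤ 2 * P.blockSize n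

/-- The block partitions exist: at the size `n`, and at every size that the recursion started at
`n` reaches, either the base case holds or the block size is positive and divides the size. -/
inductive Params.Admissible (P : Params) : ℕ → Prop
  | base (n : ℕ) (h : P.IsBase n) : P.Admissible n
  | split (n : ℕ) (h : ¬ P.IsBase n) (hpos : 0 < P.blockSize n) (hdvd : P.blockSize n ∣ n)
      (hrec : P.Admissible (P.blockSize n + P.blockSize n)) : P.Admissible n

/-- `Call P n A Q D`: recursive Jacobi, called on the `n × n` matrix `A`, may return `(Q, D)`.
In the base case it solves directly. Otherwise it starts from `(1, A)` and repeats column-cyclic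
sweeps, whose block subproblems are treated by recursive calls, until (tested after each sweep)
all off-diagonal entries of the current matrix are at most `P.tol n A`. -/
def Call (P : Params) (n : ℕ) :
    Matrix (Fin n) (Fin n) ℝ → Matrix (Fin n) (Fin n) ℝ → Matrix (Fin n) (Fin n) ℝ → Prop :=
  fun A Q D =>
    if _h : P.IsBase n then IsEigendecomposition A Q D
    else ∃ (k : ℕ) (run : ℕ → State n),
      0 < k ∧
      run 0 = (1, A) ∧
      (∀ s < k, BlockSteps (P.blockSize n) (Call P (P.blockSize n + P.blockSize n))
        (columnCyclic (n / P.blockSize n)) (run s) (run (s + 1))) ∧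
      (∀ s, 0 < s → s < k → ¬ OffEntriesLE (P.tol n A) (run s).2) ∧
      OffEntriesLE (P.tol n A) (run k).2 ∧
      run k = (Q, D)
termination_by n
decreasing_by
  simp only [Params.IsBase, not_or, not_le] at _h
  omega

/-- One sweep of recursive Jacobi at size `n` (outside the base case) may lead from `S` to `T`. -/
def Sweep (P : Params) (n : ℕ) (S T : State n) : Prop :=
  BlockSteps (P.blockSize n) (Call P (P.blockSize n + P.blockSize n))
    (columnCyclic (n / P.blockSize n)) S T

end RecJacobi

/-! By induction along the recursion, a call shrinks `offNorm` by a factor ρ < 1 that is uniform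
over all symmetric inputs and all open choices (`exists_contracts_call`). A direct solve has ρ = 0.
At any other size a returning call has made at least one sweep, so it suffices that a sweep
contracts when its recursive calls do. Positive tolerances make calls stop but do not enter the
rate.

A block step with factor ρ on a pivot submatrix of off-diagonal norm d lowers the squared
off-diagonal norm of the whole matrix by at least (1 - ρ²) d². Hence, if a sweep gains little, every
pivot submatrix is small at the moment it is treated. In block column J, the step on (I, J) with
rotation R replaces a block (I', J) still to be treated by A_{I'I} R₁₂ + A_{I'J} R₂₂. When R₂₂ has a
bounded inverse, smallness after the step and smallness of A_{I'I} give smallness before it, so the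
column was already small at its start (`abs_entry_le_of_column`). Later steps in the column cannot
enlarge the leading part that contains them. Induction over the columns bounds the final norm by the
gain of the sweep, which is a contraction (`exists_sweep_contraction`).

Pivoting provides the bounded inverse (`exists_boundedBlock_of_isLUPP`): since |L i j| ≤ 1 and the
pivoted rows are orthonormal, |det U| is bounded below. It equals |det R₁₁|, which for orthogonal R
equals |det R₂₂|. -/

namespace RecJacobi

/-! ### Off-diagonal sums of squares -/

/-- The sum of the squares of the off-diagonal entries with both indices in `S`. -/
def offSq {m : ℕ} (S : Finset (Fin m)) (A : Matrix (Fin m) (Fin m) ℝ) : ℝ :=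
  ∑ i ∈ S, ∑ j ∈ S, if i = j then 0 else A i j ^ 2

lemma offNorm_nonneg {m : ℕ} (A : Matrix (Fin m) (Fin m) ℝ) : 0 ≤ offNorm A :=
  Real.sqrt_nonneg _

lemma offNorm_sq {m : ℕ} (A : Matrix (Fin m) (Fin m) ℝ) :
    offNorm A ^ 2 = offSq Finset.univ A := by
  rw [offNorm, Real.sq_sqrt
    (Finset.sum_nonneg fun i _ => Finset.sum_nonneg fun j _ => by positivity), offSq]
  refine Finset.sum_congr rfl fun i _ => ?_
  rw [← Finset.add_sum_erase _ _ (Finset.mem_univ i)]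
  simp only [if_true, zero_add]
  refine Finset.sum_congr rfl fun j hj => ?_
  rw [if_neg (Finset.ne_of_mem_erase hj).symm, sq_abs]

lemma sq_entry_le_offSq {m : ℕ} {S : Finset (Fin m)} (A : Matrix (Fin m) (Fin m) ℝ)
    {i j : Fin m} (hi : i ∈ S) (hj : j ∈ S) (hij : i ≠ j) : A i j ^ 2 ≤ offSq S A := by
  have h0 : ∀ i j, (0 : ℝ) ≤ if i = j then 0 else A i j ^ 2 := by
    intro i j
    split_ifs
    · exact le_rfl
    · positivity
  calc A i j ^ 2 = if i = j then 0 else A i j ^ 2 := (if_neg hij).symm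
    _ ≤ ∑ j ∈ S, if i = j then 0 else A i j ^ 2 :=
        Finset.single_le_sum (f := fun j => if i = j then 0 else A i j ^ 2)
          (fun j _ => h0 i j) hj
    _ ≤ _ := Finset.single_le_sum (f := fun i => ∑ j ∈ S, if i = j then 0 else A i j ^ 2)
          (fun i _ => Finset.sum_nonneg fun j _ => h0 i j) hi

lemma abs_entry_le_of_offSq_le {m : ℕ} {S : Finset (Fin m)} {A : Matrix (Fin m) (Fin m) ℝ}
    {β : ℝ} (hβ : 0 ≤ β) (h : offSq S A ≤ β ^ 2)
    {i j : Fin m} (hi : i ∈ S) (hj : j ∈ S) (hij : i ≠ j) : |A i j| ≤ β :=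
  abs_le.2 (abs_le_of_sq_le_sq' ((sq_entry_le_offSq A hi hj hij).trans h) hβ)

lemma abs_entry_le_offNorm {m : ℕ} (A : Matrix (Fin m) (Fin m) ℝ) {i j : Fin m} (hij : i ≠ j) :
    |A i j| ≤ offNorm A :=
  abs_entry_le_of_offSq_le (offNorm_nonneg A) (offNorm_sq A).ge
    (Finset.mem_univ i) (Finset.mem_univ j) hij

lemma offSq_le_of_abs_entry_le {m : ℕ} {S : Finset (Fin m)} {A : Matrix (Fin m) (Fin m) ℝ}
    {β : ℝ} (h : ∀ i ∈ S, ∀ j ∈ S, i ≠ j → |A i j| ≤ β) :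
    offSq S A ≤ (m * β) ^ 2 := by
  have h1 : offSq S A ≤ ∑ i ∈ S, ∑ j ∈ S, β ^ 2 := by
    refine Finset.sum_le_sum fun i hi => Finset.sum_le_sum fun j hj => ?_
    split_ifs with hij
    · positivity
    · exact sq_le_sq' (abs_le.1 (h i hi j hj hij)).1 (abs_le.1 (h i hi j hj hij)).2
  have h2 : (S.card : ℝ) ≤ m := by exact_mod_cast (Finset.card_le_univ S).trans (by simp)
  calc offSq S A ≤ _ := h1
    _ = ((S.card : ℝ) * S.card) * β ^ 2 := by simp [mul_assoc]
    _ ≤ (m * m) * β ^ 2 := by gcongr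
    _ = _ := by ring

lemma offNorm_eq_zero_of_isDiag {m : ℕ} {A : Matrix (Fin m) (Fin m) ℝ} (h : A.IsDiag) :
    offNorm A = 0 := by
  rw [← sq_eq_zero_iff, offNorm_sq, offSq]
  refine Finset.sum_eq_zero fun i _ => Finset.sum_eq_zero fun j _ => ?_
  split_ifs with hij
  · rfl
  · rw [h hij]; norm_num

lemma offNorm_submatrix_perm {m : ℕ} (A : Matrix (Fin m) (Fin m) ℝ) (σ : Equiv.Perm (Fin m)) :
    offNorm (A.submatrix σ σ) = offNorm A := by
  refine (pow_left_inj₀ (offNorm_nonneg _) (offNorm_nonneg _) two_ne_zero).1 ?_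
  rw [offNorm_sq, offNorm_sq, offSq, offSq]
  exact Fintype.sum_equiv σ _ _ fun i => Fintype.sum_equiv σ _ _ fun j => by simp

/-! ### Conjugation by an embedded orthogonal matrix -/

section Embed

variable {n k : ℕ} {e : Fin k → Fin n}

lemma embed_one (e : Fin k → Fin n) : embed e 1 = 1 := by simp [embed]

lemma one_submatrix_mul_self (he : Function.Injective e) :
    (1 : Matrix (Fin n) (Fin n) ℝ).submatrix e id * (1 : Matrix (Fin n) (Fin n) ℝ).submatrix id e
      = 1 := by
  ext i j
  simp [Matrix.mul_apply, Matrix.one_apply, he.eq_iff]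

lemma mul_one_submatrix {l : Type*} (A : Matrix l (Fin n) ℝ) :
    A * (1 : Matrix (Fin n) (Fin n) ℝ).submatrix id e = A.submatrix id e := by
  ext i j
  simp [Matrix.mul_apply, Matrix.one_apply]

lemma mul_embed_submatrix {l : Type*} (he : Function.Injective e) (A : Matrix l (Fin n) ℝ)
    (R : Matrix (Fin k) (Fin k) ℝ) :
    (A * embed e R).submatrix id e = A.submatrix id e * R := by
  rw [← mul_one_submatrix, embed, Matrix.mul_assoc, Matrix.add_mul,
    Matrix.mul_assoc _ _ (_ : Matrix (Fin n) (Fin k) ℝ), one_submatrix_mul_self he, Matrix.mul_one, Matrix.one_mul, Matrix.mul_sub, Matrix.mul_one,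
    add_sub_cancel, ← Matrix.mul_assoc, mul_one_submatrix]

lemma mul_embed_apply {l : Type*} (he : Function.Injective e) (A : Matrix l (Fin n) ℝ)
    (R : Matrix (Fin k) (Fin k) ℝ) (r : l) (j : Fin k) :
    (A * embed e R) r (e j) = ∑ i, A r (e i) * R i j := by
  have := congrFun (congrFun (mul_embed_submatrix he A R) r) j
  simpa [Matrix.mul_apply] using this

lemma mul_embed_apply_of_notMem {l : Type*} (A : Matrix l (Fin n) ℝ)
    (R : Matrix (Fin k) (Fin k) ℝ) (r : l) {c : Fin n} (hc : c ∉ Set.range e) :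
    (A * embed e R) r c = A r c := by
  have h : ∀ i, ¬ e i = c := fun i hi => hc ⟨i, hi⟩
  rw [embed, Matrix.mul_add, Matrix.mul_one, Matrix.add_apply, ← Matrix.mul_assoc]
  rw [Matrix.mul_apply (N := (1 : Matrix (Fin n) (Fin n) ℝ).submatrix e id)]
  simp [h]

lemma embed_orthogonal (he : Function.Injective e) {R : Matrix (Fin k) (Fin k) ℝ}
    (hR : R.transpose * R = 1) : (embed e R).transpose * embed e R = 1 := by
  set E := (1 : Matrix (Fin n) (Fin n) ℝ).submatrix id e with hE
  have hEt : (1 : Matrix (Fin n) (Fin n) ℝ).submatrix e id = E.transpose := by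
    rw [hE, Matrix.transpose_submatrix, Matrix.transpose_one]
  have hEE : E.transpose * E = 1 := hEt ▸ one_submatrix_mul_self he
  have h1 : embed e R = 1 + E * (R - 1) * E.transpose := by rw [embed, hEt]
  rw [h1]
  simp only [Matrix.transpose_add, Matrix.transpose_mul, Matrix.transpose_transpose,
    Matrix.transpose_one]
  have h2 : E * ((R - 1).transpose * E.transpose) * (E * (R - 1) * E.transpose)
      = E * ((R - 1).transpose * (R - 1)) * E.transpose := by
    calc _ = E * (R - 1).transpose * (E.transpose * E) * (R - 1) * E.transpose := by
          simp only [Matrix.mul_assoc]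
      _ = _ := by rw [hEE]; simp only [Matrix.mul_assoc, Matrix.one_mul]
  rw [Matrix.add_mul, Matrix.one_mul, Matrix.mul_add, Matrix.mul_one, h2, ← Matrix.mul_assoc E]
  -- Orthogonality of R, expressed through N = R - 1, is NᵀN = -N - Nᵀ; this cancels the linear
  -- terms.
  have h3 : (R - 1).transpose * (R - 1) = -(R - 1) - (R - 1).transpose := by
    rw [Matrix.transpose_sub, Matrix.transpose_one, Matrix.sub_mul, Matrix.mul_sub, hR]
    simp only [Matrix.mul_one, Matrix.one_mul]
    abel
  rw [h3]
  generalize R - 1 = N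
  rw [Matrix.mul_sub, Matrix.sub_mul, Matrix.mul_neg, Matrix.neg_mul]
  abel

variable {A : Matrix (Fin n) (Fin n) ℝ} {R : Matrix (Fin k) (Fin k) ℝ}

lemma isSymm_conj (hA : A.IsSymm) {m : ℕ} (G : Matrix (Fin n) (Fin m) ℝ) :
    (G.transpose * A * G).IsSymm := by
  rw [Matrix.IsSymm, Matrix.transpose_mul, Matrix.transpose_mul, Matrix.transpose_transpose,
    hA.eq, Matrix.mul_assoc]

lemma transpose_embed_mul_apply_of_notMem (M : Matrix (Fin n) (Fin n) ℝ) {r : Fin n}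
    (hr : r ∉ Set.range e) (c : Fin n) : ((embed e R).transpose * M) r c = M r c := by
  have h := mul_embed_apply_of_notMem (e := e) M.transpose R c hr
  rw [show (embed e R).transpose * M = (M.transpose * embed e R).transpose by
    rw [Matrix.transpose_mul, Matrix.transpose_transpose], Matrix.transpose_apply]
  exact h

lemma conj_embed_apply_of_notMem {r c : Fin n} (hr : r ∉ Set.range e) (hc : c ∉ Set.range e) :
    ((embed e R).transpose * A * embed e R) r c = A r c := by
  rw [mul_embed_apply_of_notMem _ _ _ hc, transpose_embed_mul_apply_of_notMem _ hr]

lemma conj_embed_apply (he : Function.Injective e) {r : Fin n} (hr : r ∉ Set.range e) (j : Fin k) :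
    ((embed e R).transpose * A * embed e R) r (e j) = ∑ i, A r (e i) * R i j := by
  rw [Matrix.mul_assoc, transpose_embed_mul_apply_of_notMem _ hr, mul_embed_apply he]

lemma conj_embed_submatrix (he : Function.Injective e) :
    ((embed e R).transpose * A * embed e R).submatrix e e
      = R.transpose * A.submatrix e e * R := by
  ext i j
  rw [Matrix.submatrix_apply, mul_embed_apply he, Matrix.mul_apply]
  refine Finset.sum_congr rfl fun l _ => ?_
  congr 1
  have h := mul_embed_apply he A.transpose R (e l) i
  rw [show (embed e R).transpose * A = (A.transpose * embed e R).transpose by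
    rw [Matrix.transpose_mul, Matrix.transpose_transpose], Matrix.transpose_apply, h,
    Matrix.mul_apply]
  exact Finset.sum_congr rfl fun x _ => by simp [mul_comm]

lemma sum_sq_mul_orthogonal (hR : R.transpose * R = 1) (x : Fin k → ℝ) :
    ∑ j, (∑ i, x i * R i j) ^ 2 = ∑ i, x i ^ 2 := by
  have hR' : R * R.transpose = 1 := mul_eq_one_comm.1 hR
  have h1 : ∀ y : Fin k → ℝ, ∑ i, y i ^ 2 = y ⬝ᵥ y := fun y => by
    simp [dotProduct, sq]
  have h2 : ∀ j, ∑ i, x i * R i j = Matrix.vecMul x R j := fun j => rfl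
  simp only [h2]
  rw [h1, h1, ← Matrix.dotProduct_mulVec, ← Matrix.vecMul_transpose, Matrix.vecMul_vecMul, hR',
    Matrix.vecMul_one]

lemma offSq_split (he : Function.Injective e) {S : Finset (Fin n)} (hS : ∀ i, e i ∈ S)
    (hA : A.IsSymm) :
    offSq S A = offSq (S \ Finset.univ.image e) A
      + 2 * ∑ r ∈ S \ Finset.univ.image e, ∑ i, A r (e i) ^ 2
      + offNorm (A.submatrix e e) ^ 2 := by
  have hsub : Finset.univ.image e ⊆ S := by
    intro x hx
    obtain ⟨i, -, rfl⟩ := Finset.mem_image.1 hx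
    exact hS i
  have hs : ∀ f : Fin n → ℝ, ∑ i ∈ S, f i
      = ∑ i ∈ S \ Finset.univ.image e, f i + ∑ i, f (e i) := by
    intro f
    rw [← Finset.sum_sdiff hsub, Finset.sum_image fun a _ b _ h => he h]
  have hne : ∀ r ∈ S \ Finset.univ.image e, ∀ i, r ≠ e i := by
    rintro r hr i rfl
    exact (Finset.mem_sdiff.1 hr).2 (Finset.mem_image_of_mem e (Finset.mem_univ i))
  rw [offNorm_sq]
  simp only [offSq, hs, Finset.sum_add_distrib]
  have h1 : ∑ r ∈ S \ Finset.univ.image e, ∑ i, (if r = e i then 0 else A r (e i) ^ 2)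
      = ∑ r ∈ S \ Finset.univ.image e, ∑ i, A r (e i) ^ 2 :=
    Finset.sum_congr rfl fun r hr => Finset.sum_congr rfl fun i _ => if_neg (hne r hr i)
  have h2 : ∑ i, ∑ r ∈ S \ Finset.univ.image e, (if e i = r then 0 else A (e i) r ^ 2)
      = ∑ r ∈ S \ Finset.univ.image e, ∑ i, A r (e i) ^ 2 := by
    rw [Finset.sum_comm]
    refine Finset.sum_congr rfl fun r hr => Finset.sum_congr rfl fun i _ => ?_
    rw [if_neg (hne r hr i).symm, hA.apply]
  rw [h1, h2]
  simp only [he.eq_iff, Matrix.submatrix_apply]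
  ring

/-- Entries off the pivot rows and columns do not move, and each row outside the pivot has its pivot
entries multiplied by an orthogonal matrix, which keeps their sum of squares. Only the pivot
submatrix contributes a change. A general S is allowed so that the identity also applies to a
leading part of the matrix. -/
lemma offSq_conj_embed (he : Function.Injective e) {S : Finset (Fin n)} (hS : ∀ i, e i ∈ S)
    (hA : A.IsSymm) (hR : R.transpose * R = 1) :
    offSq S ((embed e R).transpose * A * embed e R)
      = offSq S A - offNorm (A.submatrix e e) ^ 2
        + offNorm (R.transpose * A.submatrix e e * R) ^ 2 := by
  have hne : ∀ r ∈ S \ Finset.univ.image e, r ∉ Set.range e := by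
    rintro r hr ⟨i, rfl⟩
    exact (Finset.mem_sdiff.1 hr).2 (Finset.mem_image_of_mem e (Finset.mem_univ i))
  rw [offSq_split he hS hA, offSq_split he hS (isSymm_conj hA _), conj_embed_submatrix he]
  have h1 : offSq (S \ Finset.univ.image e) ((embed e R).transpose * A * embed e R)
      = offSq (S \ Finset.univ.image e) A :=
    Finset.sum_congr rfl fun r hr => Finset.sum_congr rfl fun c hc => by
      rw [conj_embed_apply_of_notMem (hne r hr) (hne c hc)]
  have h2 : ∑ r ∈ S \ Finset.univ.image e, ∑ i,
        ((embed e R).transpose * A * embed e R) r (e i) ^ 2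
      = ∑ r ∈ S \ Finset.univ.image e, ∑ i, A r (e i) ^ 2 :=
    Finset.sum_congr rfl fun r hr => by
      rw [← sum_sq_mul_orthogonal hR fun i => A r (e i)]
      exact Finset.sum_congr rfl fun j _ => by rw [conj_embed_apply he (hne r hr)]
  rw [h1, h2]
  ring

end Embed

/-! ### LU factorization with partial pivoting -/

lemma isLUPP_iff {m k : ℕ} (M : Matrix (Fin m) (Fin k) ℝ) (σ : Equiv.Perm (Fin m))
    (L : Matrix (Fin m) (Fin k) ℝ) (U : Matrix (Fin k) (Fin k) ℝ) :
    M = (σ.permMatrix ℝ).transpose * L * U ↔ M.submatrix σ id = L * U := by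
  rw [Matrix.mul_assoc, Matrix.transpose_permMatrix, PEquiv.toMatrix_toPEquiv_mul]
  constructor
  · rintro rfl
    ext i j
    simp
  · intro h
    rw [← h]
    ext i j
    simp

/-- Every matrix with at least as many rows as columns has an LU factorization with partial
pivoting. -/
lemma exists_isLUPP : ∀ (k m : ℕ), k ≤ m → ∀ M : Matrix (Fin m) (Fin k) ℝ,
    ∃ σ L U, IsLUPP M σ L U
  | 0, m, _, M => by
    refine ⟨1, fun _ j => j.elim0, fun j => j.elim0, ?_, fun _ j => j.elim0, fun _ j => j.elim0,
      fun _ j => j.elim0, fun i => i.elim0⟩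
    ext i j
    exact j.elim0
  | k + 1, 0, h, M => by omega
  | k + 1, m + 1, h, M => by
    obtain ⟨i₀, -, hi₀⟩ := Finset.exists_max_image Finset.univ (fun i => |M i 0|)
      ⟨0, Finset.mem_univ _⟩
    set M₁ : Matrix (Fin (m + 1)) (Fin (k + 1)) ℝ := M.submatrix (Equiv.swap 0 i₀) id with hM₁
    have hpiv : ∀ i, |M₁ i 0| ≤ |M₁ 0 0| := fun i => by
      simpa [hM₁] using hi₀ _ (Finset.mem_univ _)
    -- A zero pivot forces the whole column to vanish; division by zero then gives multipliers 0,
    -- and `hlM` still holds.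
    set l : Fin m → ℝ := fun i => M₁ i.succ 0 / M₁ 0 0 with hl
    have hl1 : ∀ i, |l i| ≤ 1 := fun i => by
      rw [hl, abs_div]
      exact div_le_one_of_le₀ (hpiv _) (abs_nonneg _)
    have hlM : ∀ i, l i * M₁ 0 0 = M₁ i.succ 0 := fun i => by
      by_cases h0 : M₁ 0 0 = 0
      · have := hpiv i.succ
        rw [h0, abs_zero] at this
        rw [h0, mul_zero, abs_nonpos_iff.1 this]
      · exact div_mul_cancel₀ _ h0
    obtain ⟨σ, L, U, hS, hL0, hL1, hL2, hU⟩ := exists_isLUPP k m (by omega)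
      (Matrix.of fun i j => M₁ i.succ j.succ - l i * M₁ 0 j.succ)
    rw [isLUPP_iff] at hS
    have hS' : ∀ i j, M₁ (σ i).succ j.succ = l (σ i) * M₁ 0 j.succ + ∑ x, L i x * U x j :=
      fun i j => by
        have := congrFun (congrFun hS i) j
        rw [Matrix.mul_apply] at this
        rw [← this]
        simp
    -- `decomposeFin.symm (0, σ)` fixes row 0 and permutes the others by σ, so the multipliers are
    -- carried along as `l (σ i)`.
    refine ⟨Equiv.swap 0 i₀ * Equiv.Perm.decomposeFin.symm (0, σ),
      Matrix.of (Fin.cons (Fin.cons 1 fun _ => 0) fun i => Fin.cons (l (σ i)) (L i)),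
      Matrix.of (Fin.cons (M₁ 0) fun i => Fin.cons 0 (U i)), ?_, ?_, ?_, ?_, ?_⟩
    · rw [isLUPP_iff]
      have h1 : M.submatrix (Equiv.swap 0 i₀ * Equiv.Perm.decomposeFin.symm (0, σ) :
          Equiv.Perm (Fin (m + 1))) id
          = M₁.submatrix (Equiv.Perm.decomposeFin.symm (0, σ)) id := rfl
      rw [h1]
      ext i j
      rw [Matrix.mul_apply, Fin.sum_univ_succ]
      refine Fin.cases ?_ (fun i => ?_) i
      · simp
      · refine Fin.cases ?_ (fun j => ?_) j
        · simp [hlM]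
        · simp [hS']
    · intro i j
      refine Fin.cases ?_ (fun i => ?_) i <;> refine Fin.cases ?_ (fun j => ?_) j
      · simp
      · simp
      · simp
      · simpa using hL0 i j
    · intro i j
      refine Fin.cases ?_ (fun i => ?_) i <;> refine Fin.cases ?_ (fun j => ?_) j
      · simp
      · simp
      · simp
      · simpa using hL1 i j
    · intro i j
      refine Fin.cases ?_ (fun i => ?_) i <;> refine Fin.cases ?_ (fun j => ?_) j
      · simp
      · simp
      · simpa using hl1 (σ i)
      · simpa using hL2 i j
    · intro i j
      refine Fin.cases ?_ (fun i => ?_) i <;> refine Fin.cases ?_ (fun j => ?_) j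
      · simp
      · simp
      · simp
      · simpa using hU i j

/-! ### Bounded invertibility of the pivoted diagonal blocks -/

/-- Since the rows of M are orthonormal, multiplying M by [M₁₁ᵀ, 0; M₁₂ᵀ, 1] gives [1, M₁₂; 0, M₂₂].
Take determinants and use |det M| = 1. -/
lemma abs_det_toBlocks_eq {b : Type*} [Fintype b] [DecidableEq b]
    (M : Matrix (b ⊕ b) (b ⊕ b) ℝ) (hM : M * M.transpose = 1) :
    |M.toBlocks₁₁.det| = |M.toBlocks₂₂.det| := by
  have hdet : |M.det| = 1 := by
    have h := congrArg Matrix.det hM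
    rw [Matrix.det_mul, Matrix.det_transpose, Matrix.det_one] at h
    rw [← abs_mul_abs_self, mul_self_eq_one_iff] at h
    rcases h with h | h
    · exact h
    · linarith [abs_nonneg M.det]
  have hM' := hM
  rw [← Matrix.fromBlocks_toBlocks M, Matrix.fromBlocks_transpose, Matrix.fromBlocks_multiply,
    ← Matrix.fromBlocks_one, Matrix.fromBlocks_inj] at hM'
  obtain ⟨h11, -, h21, -⟩ := hM'
  have hprod : M * Matrix.fromBlocks M.toBlocks₁₁.transpose 0 M.toBlocks₁₂.transpose 1
      = Matrix.fromBlocks 1 M.toBlocks₁₂ 0 M.toBlocks₂₂ := by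
    conv_lhs => rw [← Matrix.fromBlocks_toBlocks M]
    rw [Matrix.fromBlocks_multiply]
    simp [h11, h21]
  have h := congrArg Matrix.det hprod
  rw [Matrix.det_mul, Matrix.det_fromBlocks_zero₁₂, Matrix.det_fromBlocks_zero₂₁,
    Matrix.det_one, Matrix.det_transpose, mul_one, one_mul] at h
  rw [← h, abs_mul, hdet, one_mul]

lemma abs_det_le {b : ℕ} {M : Matrix (Fin b) (Fin b) ℝ} {x : ℝ} (h : ∀ i j, |M i j| ≤ x) :
    |M.det| ≤ b.factorial * x ^ b := by
  have := Matrix.det_le (abv := AbsoluteValue.abs) (A := M) (x := x) h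
  simpa using this

lemma abs_entry_le_one_of_orthogonal {m : ℕ} {R : Matrix (Fin m) (Fin m) ℝ}
    (hR : R.transpose * R = 1) (i j : Fin m) : |R i j| ≤ 1 := by
  have h := congrFun (congrFun hR j) j
  rw [Matrix.mul_apply, Matrix.one_apply_eq] at h
  rw [← sq_le_one_iff_abs_le_one, ← h]
  simp only [Matrix.transpose_apply, ← sq]
  exact Finset.single_le_sum (f := fun i => R i j ^ 2) (fun _ _ => sq_nonneg _)
    (Finset.mem_univ i)

/-- The lower right block of `R` has a right inverse whose entries are at most `K` in absolute
value. -/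
def BoundedBlock {b : ℕ} (K : ℝ) (R : Matrix (Fin (b + b)) (Fin (b + b)) ℝ) : Prop :=
  ∃ X : Matrix (Fin b) (Fin b) ℝ,
    R.submatrix (Fin.natAdd b) (Fin.natAdd b) * X = 1 ∧ ∀ i j, |X i j| ≤ K

/-- The determinant bound passes to the complementary block, whose inverse is then bounded by
Cramer's rule: its adjugate consists of determinants of matrices with entries at most 1, hence at
most b!. -/
lemma boundedBlock_of_le_abs_det {b : ℕ} {R : Matrix (Fin (b + b)) (Fin (b + b)) ℝ}
    (hR : R.transpose * R = 1) {c : ℝ} (hc : 0 < c)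
    (hdet : c ≤ |(R.submatrix (Fin.castAdd b) (Fin.castAdd b)).det|) :
    BoundedBlock (b.factorial / c) R := by
  have hR' : R * R.transpose = 1 := mul_eq_one_comm.1 hR
  have h := abs_det_toBlocks_eq (R.submatrix finSumFinEquiv finSumFinEquiv) (by
    rw [Matrix.transpose_submatrix, Matrix.submatrix_mul_equiv, hR', Matrix.submatrix_one_equiv])
  have h1 : (R.submatrix finSumFinEquiv finSumFinEquiv).toBlocks₁₁
      = R.submatrix (Fin.castAdd b) (Fin.castAdd b) := by ext; simp [Matrix.toBlocks₁₁]
  have h2 : (R.submatrix finSumFinEquiv finSumFinEquiv).toBlocks₂₂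
      = R.submatrix (Fin.natAdd b) (Fin.natAdd b) := by ext; simp [Matrix.toBlocks₂₂]
  rw [h1, h2] at h
  rw [h] at hdet
  set N := R.submatrix (Fin.natAdd b) (Fin.natAdd b) with hN
  have hN0 : N.det ≠ 0 := abs_pos.1 (hc.trans_le hdet)
  refine ⟨N⁻¹, Matrix.mul_nonsing_inv _ (isUnit_iff_ne_zero.2 hN0), fun i j => ?_⟩
  rw [Matrix.inv_def, Matrix.smul_apply, smul_eq_mul, Ring.inverse_eq_inv', abs_mul, abs_inv,
    mul_comm, ← div_eq_mul_inv]
  have hadj : |N.adjugate i j| ≤ b.factorial := by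
    rw [Matrix.adjugate_apply]
    have := abs_det_le (M := N.updateRow j (Pi.single i 1)) (x := 1) fun r c => by
      rw [Matrix.updateRow_apply]
      split_ifs
      · rw [Pi.single_apply]
        split_ifs <;> simp
      · exact abs_entry_le_one_of_orthogonal hR _ _
    simpa using this
  gcongr

lemma orthogonal_mul_permMatrix {m : ℕ} {Q : Matrix (Fin m) (Fin m) ℝ} (hQ : Q.transpose * Q = 1)
    (σ : Equiv.Perm (Fin m)) :
    (Q * (σ.permMatrix ℝ).transpose).transpose * (Q * (σ.permMatrix ℝ).transpose) = 1 := by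
  rw [Matrix.transpose_mul, Matrix.mul_assoc, ← Matrix.mul_assoc Q.transpose, hQ, Matrix.one_mul,
    Matrix.transpose_transpose, Matrix.transpose_permMatrix, ← Matrix.permMatrix_mul]
  simp

/-- Pivoting by LUPP bounds the diagonal blocks of an orthogonal matrix away from singularity. -/
lemma exists_boundedBlock_of_isLUPP (b : ℕ) : ∃ K : ℝ, 1 ≤ K ∧
    ∀ (Q : Matrix (Fin (b + b)) (Fin (b + b)) ℝ) (σ : Equiv.Perm (Fin (b + b)))
      (L : Matrix (Fin (b + b)) (Fin b) ℝ) (U : Matrix (Fin b) (Fin b) ℝ),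
      Q.transpose * Q = 1 →
      IsLUPP (Q.submatrix (Fin.castAdd b) id).transpose σ L U →
      BoundedBlock K (Q * (σ.permMatrix ℝ).transpose) := by
  -- D bounds det(LᵀL): the entries of this b × b matrix are sums of 2b terms of absolute value at
  -- most 1.
  set D : ℝ := b.factorial * ((b + b : ℕ) : ℝ) ^ b with hD
  have hD1 : 1 ≤ D := by
    rcases Nat.eq_zero_or_pos b with rfl | hb
    · simp [hD]
    · have h1 : (1 : ℝ) ≤ b.factorial := by exact_mod_cast b.factorial_pos
      have h2 : (1 : ℝ) ≤ (b + b : ℕ) := by exact_mod_cast (by omega)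
      exact one_le_mul_of_one_le_of_one_le h1 (one_le_pow₀ h2)
  have hD0 : 0 < D := by linarith
  have hsD : 1 ≤ Real.sqrt D := Real.one_le_sqrt.2 hD1
  -- Here 1/√D is the lower bound for the determinant of the upper left block.
  refine ⟨b.factorial / (1 / Real.sqrt D), ?_, ?_⟩
  · rw [div_div_eq_mul_div, div_one]
    exact one_le_mul_of_one_le_of_one_le (by exact_mod_cast b.factorial_pos) hsD
  intro Q σ L U hQ ⟨hM, hL0, hL1, hL2, hU⟩
  refine boundedBlock_of_le_abs_det (orthogonal_mul_permMatrix hQ σ) (by positivity) ?_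
  rw [isLUPP_iff] at hM
  have hLU : ∀ i j, Q (Fin.castAdd b j) (σ i) = ∑ x, L i x * U x j := fun i j => by
    have := congrFun (congrFun hM i) j
    rw [Matrix.mul_apply] at this
    rw [← this]
    simp
  have hR11 : (Q * (σ.permMatrix ℝ).transpose).submatrix (Fin.castAdd b) (Fin.castAdd b)
      = (L.submatrix (Fin.castAdd b) id * U).transpose := by
    ext i j
    rw [Matrix.transpose_permMatrix, PEquiv.mul_toMatrix_toPEquiv]
    rw [Matrix.transpose_apply, Matrix.mul_apply]
    simpa [Equiv.Perm.inv_def] using hLU (Fin.castAdd b j) i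
  have hdetL : (L.submatrix (Fin.castAdd b) id).det = 1 := by
    have ht : (L.submatrix (Fin.castAdd b) id).IsLowerTriangular :=
      fun i j hij => hL0 _ _ (by simpa using hij)
    rw [Matrix.det_of_isLowerTriangular _ ht]
    exact Finset.prod_eq_one fun i _ => hL1 _ _ (by simp)
  have hLabs : ∀ i j, |L i j| ≤ 1 := fun i j => by
    rcases lt_trichotomy (i : ℕ) (j : ℕ) with h | h | h
    · simp [hL0 i j h]
    · simp [hL1 i j h]
    · exact hL2 i j h
  have hQ' : Q * Q.transpose = 1 := mul_eq_one_comm.1 hQ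
  -- The columns of LU are the first b rows of Q up to a common reordering of their entries, hence
  -- orthonormal.
  have hgram : U.transpose * (L.transpose * L) * U = 1 := by
    have h1 : U.transpose * (L.transpose * L) * U = (L * U).transpose * (L * U) := by
      rw [Matrix.transpose_mul]
      simp only [Matrix.mul_assoc]
    rw [h1, ← hM]
    ext i j
    have h2 := congrFun (congrFun hQ' (Fin.castAdd b i)) (Fin.castAdd b j)
    rw [Matrix.mul_apply] at h2 ⊢
    rw [← Equiv.sum_comp σ] at h2
    simpa [Matrix.one_apply] using h2
  have hdetgram : |(L.transpose * L).det| ≤ D := by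
    refine abs_det_le fun i j => ?_
    rw [Matrix.mul_apply]
    calc |∑ x, L.transpose i x * L x j| ≤ ∑ x, |L.transpose i x * L x j| :=
          Finset.abs_sum_le_sum_abs _ _
      _ ≤ ∑ x : Fin (b + b), (1 : ℝ) := by
          refine Finset.sum_le_sum fun x _ => ?_
          rw [abs_mul]
          exact mul_le_one₀ (hLabs _ _) (abs_nonneg _) (hLabs _ _)
      _ = _ := by simp
  have hdetU : 1 ≤ |U.det| ^ 2 * D := by
    have h := congrArg Matrix.det hgram
    rw [Matrix.det_mul, Matrix.det_mul, Matrix.det_transpose, Matrix.det_one] at h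
    calc (1 : ℝ) = |U.det| ^ 2 * (L.transpose * L).det := by rw [sq_abs, ← h]; ring
      _ ≤ |U.det| ^ 2 * D := by
          gcongr
          exact (le_abs_self _).trans hdetgram
  rw [hR11, Matrix.det_transpose, Matrix.det_mul, hdetL, one_mul,
    div_le_iff₀ (by positivity)]
  rw [← abs_of_nonneg (mul_nonneg (abs_nonneg U.det) (Real.sqrt_nonneg D)),
    ← one_le_sq_iff_one_le_abs, mul_pow, Real.sq_sqrt hD0.le]
  exact hdetU

/-- Symmetric matrices have an eigendecomposition. -/
lemma exists_isEigendecomposition {m : ℕ} {A : Matrix (Fin m) (Fin m) ℝ} (hA : A.IsSymm) :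
    ∃ Q D, IsEigendecomposition A Q D := by
  have hH : A.IsHermitian := by
    rw [Matrix.IsHermitian, Matrix.conjTranspose_eq_transpose_of_trivial, hA.eq]
  refine ⟨hH.eigenvectorUnitary, Matrix.diagonal hH.eigenvalues, ?_,
    Matrix.isDiag_diagonal _, ?_⟩
  · have := Unitary.coe_star_mul_self hH.eigenvectorUnitary
    rwa [Matrix.star_eq_conjTranspose, Matrix.conjTranspose_eq_transpose_of_trivial] at this
  · have h := hH.spectral_theorem
    rw [Unitary.conjStarAlgAut_apply, Matrix.star_eq_conjTranspose,
      Matrix.conjTranspose_eq_transpose_of_trivial] at h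
    exact h

/-! ### Block indices and the gain of a Jacobi step -/

/-- Steps of the relation `r` along the entries of a list, one after the other. -/
def Chain {α β : Type*} (r : α → β → β → Prop) : List α → β → β → Prop
  | [], A, B => B = A
  | x :: l, A, B => ∃ C, r x A C ∧ Chain r l C B

lemma chain_append {α β : Type*} {r : α → β → β → Prop} {l l' : List α} {A B : β} :
    Chain r (l ++ l') A B ↔ ∃ C, Chain r l A C ∧ Chain r l' C B := by
  induction l generalizing A with
  | nil => simp [Chain]
  | cons x l ih =>
    simp only [List.cons_append, Chain, ih]
    constructor
    · rintro ⟨C, h, D, h1, h2⟩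
      exact ⟨D, ⟨C, h, h1⟩, h2⟩
    · rintro ⟨D, ⟨C, h, h1⟩, h2⟩
      exact ⟨C, h, D, h1, h2⟩

section Blocks

variable {n b : ℕ}

lemma blockIdx_div (I : Fin (n / b)) (i : Fin b) : (blockIdx n b I i : ℕ) / b = I := by
  have hb : 0 < b := i.pos
  simp only [blockIdx]
  rw [Nat.mul_comm, Nat.mul_add_div hb, Nat.div_eq_of_lt i.isLt, add_zero]

lemma blockIdx_inj {I J : Fin (n / b)} {i j : Fin b} :
    blockIdx n b I i = blockIdx n b J j ↔ I = J ∧ i = j := by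
  constructor
  · intro h
    have hIJ : I = J := Fin.ext (by rw [← blockIdx_div I i, ← blockIdx_div J j, h])
    subst hIJ
    refine ⟨rfl, Fin.ext ?_⟩
    simpa [blockIdx] using h
  · rintro ⟨rfl, rfl⟩
    rfl

lemma exists_blockIdx_eq (hb : 0 < b) (hdvd : b ∣ n) (r : Fin n) :
    ∃ I i, blockIdx n b I i = r := by
  refine ⟨⟨r / b, Nat.div_lt_div_of_lt_of_dvd hdvd r.isLt⟩, ⟨r % b, Nat.mod_lt _ hb⟩, Fin.ext ?_⟩
  simp only [blockIdx]
  exact Nat.div_add_mod' _ _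

lemma pairIdx_castAdd (I J : Fin (n / b)) (i : Fin b) :
    pairIdx n b I J (Fin.castAdd b i) = blockIdx n b I i := Fin.addCases_left i

lemma pairIdx_natAdd (I J : Fin (n / b)) (i : Fin b) :
    pairIdx n b I J (Fin.natAdd b i) = blockIdx n b J i := Fin.addCases_right i

lemma pairIdx_injective {I J : Fin (n / b)} (hIJ : I ≠ J) :
    Function.Injective (pairIdx n b I J) := by
  intro x y
  refine Fin.addCases (fun i => ?_) (fun i => ?_) x <;>
    refine Fin.addCases (fun j => ?_) (fun j => ?_) y <;>
    simp only [pairIdx_castAdd, pairIdx_natAdd, blockIdx_inj]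
  · rintro ⟨-, rfl⟩
    rfl
  · exact fun h => absurd h.1 hIJ
  · exact fun h => absurd h.1.symm hIJ
  · rintro ⟨-, rfl⟩
    rfl

lemma pairIdx_div (I J : Fin (n / b)) (x : Fin (b + b)) :
    (pairIdx n b I J x : ℕ) / b = I ∨ (pairIdx n b I J x : ℕ) / b = J := by
  refine Fin.addCases (fun i => ?_) (fun i => ?_) x
  · exact Or.inl (by rw [pairIdx_castAdd, blockIdx_div])
  · exact Or.inr (by rw [pairIdx_natAdd, blockIdx_div])

lemma blockIdx_notMem_range_pairIdx {I J I' : Fin (n / b)} (h1 : I' ≠ I) (h2 : I' ≠ J)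
    (i : Fin b) : blockIdx n b I' i ∉ Set.range (pairIdx n b I J) := by
  rintro ⟨x, hx⟩
  have h := pairIdx_div I J x
  rw [hx, blockIdx_div] at h
  rcases h with h | h
  · exact h1 (Fin.ext h)
  · exact h2 (Fin.ext h)

/-- The submatrix of `A` in the block rows and columns of a pair. -/
abbrev pairSub (A : Matrix (Fin n) (Fin n) ℝ) (IJ : Fin (n / b) × Fin (n / b)) :
    Matrix (Fin (b + b)) (Fin (b + b)) ℝ :=
  A.submatrix (pairIdx n b IJ.1 IJ.2) (pairIdx n b IJ.1 IJ.2)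

/-- A block Jacobi rotation on the pair `IJ` that shrinks the off-diagonal norm of the pivot
submatrix by a factor `ρ` and whose lower right block is boundedly invertible. -/
def JacobiStep (K ρ : ℝ) (IJ : Fin (n / b) × Fin (n / b)) (A B : Matrix (Fin n) (Fin n) ℝ) :
    Prop :=
  IJ.1 < IJ.2 ∧ ∃ R : Matrix (Fin (b + b)) (Fin (b + b)) ℝ, R.transpose * R = 1 ∧
    BoundedBlock K R ∧ offNorm (R.transpose * pairSub A IJ * R) ≤ ρ * offNorm (pairSub A IJ) ∧
    B = (embed (pairIdx n b IJ.1 IJ.2) R).transpose * A * embed (pairIdx n b IJ.1 IJ.2) R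

variable {K ρ δ : ℝ} {IJ : Fin (n / b) × Fin (n / b)} {A B : Matrix (Fin n) (Fin n) ℝ}

lemma JacobiStep.isSymm (h : JacobiStep K ρ IJ A B) (hA : A.IsSymm) : B.IsSymm := by
  obtain ⟨-, R, -, -, -, rfl⟩ := h
  exact isSymm_conj hA _

lemma JacobiStep.offSq_add_le (h : JacobiStep K ρ IJ A B) (hA : A.IsSymm)
    {S : Finset (Fin n)} (hS : ∀ i, pairIdx n b IJ.1 IJ.2 i ∈ S) :
    offSq S B + (1 - ρ ^ 2) * offNorm (pairSub A IJ) ^ 2 ≤ offSq S A := by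
  obtain ⟨hlt, R, hR, -, hρ, rfl⟩ := h
  rw [offSq_conj_embed (pairIdx_injective hlt.ne) hS hA hR]
  have h2 := pow_le_pow_left₀ (offNorm_nonneg _) hρ 2
  rw [mul_pow] at h2
  linarith

lemma JacobiStep.offSq_le (h : JacobiStep K ρ IJ A B) (hρ0 : 0 ≤ ρ) (hρ1 : ρ < 1)
    (hA : A.IsSymm) {S : Finset (Fin n)} (hS : ∀ i, pairIdx n b IJ.1 IJ.2 i ∈ S) :
    offSq S B ≤ offSq S A := by
  have h1 := h.offSq_add_le hA hS
  have h2 : 0 ≤ (1 - ρ ^ 2) * offNorm (pairSub A IJ) ^ 2 :=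
    mul_nonneg (by nlinarith) (sq_nonneg _)
  linarith

lemma offSq_le_of_chain (hρ0 : 0 ≤ ρ) (hρ1 : ρ < 1) {S : Finset (Fin n)}
    {l : List (Fin (n / b) × Fin (n / b))} (hA : A.IsSymm) (h : Chain (JacobiStep K ρ) l A B)
    (hS : ∀ IJ ∈ l, ∀ i, pairIdx n b IJ.1 IJ.2 i ∈ S) : B.IsSymm ∧ offSq S B ≤ offSq S A := by
  induction l generalizing A with
  | nil =>
    obtain rfl : B = A := h
    exact ⟨hA, le_rfl⟩
  | cons IJ l ih =>
    obtain ⟨C, h1, h2⟩ := h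
    obtain ⟨h3, h4⟩ := ih (h1.isSymm hA) h2 fun IJ hIJ => hS IJ (List.mem_cons_of_mem _ hIJ)
    exact ⟨h3, h4.trans (h1.offSq_le hρ0 hρ1 hA (hS IJ List.mem_cons_self))⟩

/-- A Jacobi step whose pivot submatrix has off-diagonal norm at most `δ`. -/
def SmallStep (K ρ δ : ℝ) (IJ : Fin (n / b) × Fin (n / b)) (A B : Matrix (Fin n) (Fin n) ℝ) :
    Prop :=
  JacobiStep K ρ IJ A B ∧ offNorm (pairSub A IJ) ≤ δ

lemma chain_jacobiStep_of_smallStep {l : List (Fin (n / b) × Fin (n / b))}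
    (h : Chain (SmallStep K ρ δ) l A B) : Chain (JacobiStep K ρ) l A B := by
  induction l generalizing A with
  | nil => exact h
  | cons IJ l ih =>
    obtain ⟨C, h1, h2⟩ := h
    exact ⟨C, h1.1, ih h2⟩

/-- The losses of the individual steps are nonnegative and add up to the total loss, so each is at
most (1 - ρ²) δ². -/
lemma chain_smallStep_of_offSq_sub_le (hρ0 : 0 ≤ ρ) (hρ1 : ρ < 1) (hδ : 0 ≤ δ)
    {l : List (Fin (n / b) × Fin (n / b))} (hA : A.IsSymm) (h : Chain (JacobiStep K ρ) l A B)
    (hle : offSq Finset.univ A - offSq Finset.univ B ≤ (1 - ρ ^ 2) * δ ^ 2) :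
    Chain (SmallStep K ρ δ) l A B := by
  induction l generalizing A with
  | nil => exact h
  | cons IJ l ih =>
    obtain ⟨C, h1, h2⟩ := h
    have hC := (offSq_le_of_chain hρ0 hρ1 (S := Finset.univ) (h1.isSymm hA) h2
      fun _ _ _ => Finset.mem_univ _).2
    have h3 := h1.offSq_add_le hA (S := Finset.univ) fun _ => Finset.mem_univ _
    have hρ : 0 < 1 - ρ ^ 2 := by nlinarith
    have h4 : 0 ≤ (1 - ρ ^ 2) * offNorm (pairSub A IJ) ^ 2 :=
      mul_nonneg hρ.le (sq_nonneg _)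
    refine ⟨C, ⟨h1, ?_⟩, ih (h1.isSymm hA) h2 (by linarith)⟩
    have h5 : offNorm (pairSub A IJ) ^ 2 ≤ δ ^ 2 := le_of_mul_le_mul_left (by linarith) hρ
    exact (pow_le_pow_iff_left₀ (offNorm_nonneg _) hδ two_ne_zero).1 h5

lemma abs_le_of_abs_vecMul_le {N X : Matrix (Fin b) (Fin b) ℝ} (hNX : N * X = 1) {β : ℝ}
    (hX : ∀ i j, |X i j| ≤ K) {y : Fin b → ℝ} (hβ : ∀ j, |∑ k, y k * N k j| ≤ β) (j : Fin b) :
    |y j| ≤ b * (β * K) := by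
  have hy : y j = ∑ k, Matrix.vecMul y N k * X k j := by
    have : Matrix.vecMul (Matrix.vecMul y N) X = y := by
      rw [Matrix.vecMul_vecMul, hNX, Matrix.vecMul_one]
    conv_lhs => rw [← this]
    rfl
  rw [hy]
  calc |∑ k, Matrix.vecMul y N k * X k j| ≤ ∑ k, |Matrix.vecMul y N k * X k j| :=
        Finset.abs_sum_le_sum_abs _ _
    _ ≤ ∑ k : Fin b, β * K := by
        refine Finset.sum_le_sum fun k _ => ?_
        rw [abs_mul]
        exact mul_le_mul (hβ k) (hX k j) (abs_nonneg _) ((abs_nonneg _).trans (hβ k))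
    _ = _ := by simp

/-- This is the backward estimate. The new block is A_{I'I} R₁₂ + A_{I'J} R₂₂; subtract the first
term, whose entries are at most bα because |R i j| ≤ 1, and undo R₂₂ by its bounded right inverse.
-/
lemma SmallStep.abs_entry_le {I J I' : Fin (n / b)} (h : SmallStep K ρ δ (I, J) A B)
    (h1 : I' ≠ I) (h2 : I' ≠ J) {α β : ℝ} (i : Fin b)
    (hα : ∀ j, |A (blockIdx n b I' i) (blockIdx n b I j)| ≤ α)
    (hβ : ∀ j, |B (blockIdx n b I' i) (blockIdx n b J j)| ≤ β) (j : Fin b) :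
    |A (blockIdx n b I' i) (blockIdx n b J j)| ≤ b * ((β + b * α) * K) := by
  obtain ⟨⟨hlt, R, hR, ⟨X, hX, hXK⟩, -, rfl⟩, -⟩ := h
  refine abs_le_of_abs_vecMul_le hX hXK
    (y := fun j => A (blockIdx n b I' i) (blockIdx n b J j)) (fun j => ?_) j
  have h3 := conj_embed_apply (A := A) (R := R) (pairIdx_injective hlt.ne)
    (blockIdx_notMem_range_pairIdx h1 h2 i) (Fin.natAdd b j)
  rw [Fin.sum_univ_add] at h3
  simp only [pairIdx_natAdd, pairIdx_castAdd] at h3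
  have h4 := hβ j
  rw [h3] at h4
  have h5 : |∑ k, A (blockIdx n b I' i) (blockIdx n b I k) * R (Fin.castAdd b k) (Fin.natAdd b j)|
      ≤ b * α := by
    calc _ ≤ ∑ k, |A (blockIdx n b I' i) (blockIdx n b I k) *
          R (Fin.castAdd b k) (Fin.natAdd b j)| := Finset.abs_sum_le_sum_abs _ _
      _ ≤ ∑ k : Fin b, α := by
          refine Finset.sum_le_sum fun k _ => ?_
          rw [abs_mul]
          exact (mul_le_of_le_one_right (abs_nonneg _)
            (abs_entry_le_one_of_orthogonal hR _ _)).trans (hα k)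
      _ = _ := by simp
  simp only [Matrix.submatrix_apply]
  rw [abs_le] at h4 h5 ⊢
  constructor <;> linarith [h4.1, h4.2, h5.1, h5.2]

lemma SmallStep.apply_eq {I J I₁ I₂ : Fin (n / b)} (h : SmallStep K ρ δ (I, J) A B)
    (h1 : I₁ ≠ I) (h1' : I₁ ≠ J) (h2 : I₂ ≠ I) (h2' : I₂ ≠ J) (i j : Fin b) :
    B (blockIdx n b I₁ i) (blockIdx n b I₂ j) = A (blockIdx n b I₁ i) (blockIdx n b I₂ j) := by
  obtain ⟨⟨-, R, -, -, -, rfl⟩, -⟩ := h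
  exact conj_embed_apply_of_notMem (blockIdx_notMem_range_pairIdx h1 h1' i)
    (blockIdx_notMem_range_pairIdx h2 h2' j)

lemma SmallStep.abs_pairSub_le (h : SmallStep K ρ δ IJ A B) {x y : Fin (b + b)} (hxy : x ≠ y) :
    |A (pairIdx n b IJ.1 IJ.2 x) (pairIdx n b IJ.1 IJ.2 y)| ≤ δ :=
  (abs_entry_le_offNorm (pairSub A IJ) hxy).trans h.2

/-! ### Contraction over a column-cyclic sweep -/

/-- If all pivot submatrices in a block column are small when they are treated, then the entries
of that block column were already small at its start. -/
lemma abs_entry_le_of_column (hK : 0 ≤ K) {a : ℝ} (ha : 0 ≤ a) (ρ : ℝ) (J : Fin (n / b))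
    (l : List (Fin (n / b))) (hl : l.Nodup) (hJ : J ∉ l) : ∃ c : ℝ, 0 ≤ c ∧
    ∀ (δ : ℝ) (A B : Matrix (Fin n) (Fin n) ℝ), 0 ≤ δ → A.IsSymm →
      (∀ I₁ ∈ l, ∀ I₂ ∈ l, I₁ ≠ I₂ → ∀ i j,
        |A (blockIdx n b I₁ i) (blockIdx n b I₂ j)| ≤ a * δ) →
      Chain (SmallStep K ρ δ) (l.map fun I => (I, J)) A B →
      (∀ I ∈ l, ∀ i j, |A (blockIdx n b I i) (blockIdx n b J j)| ≤ c * δ) ∧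
      (∀ I ∈ l, ∀ i j, i ≠ j → |A (blockIdx n b I i) (blockIdx n b I j)| ≤ δ) ∧
      (l ≠ [] → ∀ i j, i ≠ j → |A (blockIdx n b J i) (blockIdx n b J j)| ≤ δ) := by
  induction l with
  | nil => exact ⟨0, le_rfl, by simp⟩
  | cons I l ih =>
    rw [List.nodup_cons] at hl
    rw [List.mem_cons, not_or] at hJ
    obtain ⟨c, hc, hcol⟩ := ih hl.2 hJ.2
    -- The 1 covers block I, itself part of the first pivot. The other term is the backward estimate
    -- for the remaining blocks, with α = aδ and β = cδ from the tail of the column.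
    refine ⟨1 + b * ((c + b * a) * K), by positivity, fun δ A B hδ hA hinter h => ?_⟩
    obtain ⟨C, h1, h2⟩ := h
    have hne : ∀ I' ∈ l, I' ≠ I ∧ I' ≠ J := fun I' hI' =>
      ⟨fun h => hl.1 (h ▸ hI'), fun h => hJ.2 (h ▸ hI')⟩
    have heq : ∀ I₁ ∈ l, ∀ I₂ ∈ l, ∀ i j, C (blockIdx n b I₁ i) (blockIdx n b I₂ j)
        = A (blockIdx n b I₁ i) (blockIdx n b I₂ j) := fun I₁ hI₁ I₂ hI₂ i j =>
      h1.apply_eq (hne I₁ hI₁).1 (hne I₁ hI₁).2 (hne I₂ hI₂).1 (hne I₂ hI₂).2 i j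
    obtain ⟨h3, h4, -⟩ := hcol δ C B hδ (h1.1.isSymm hA) (fun I₁ hI₁ I₂ hI₂ h12 i j => by
      rw [heq I₁ hI₁ I₂ hI₂]
      exact hinter I₁ (List.mem_cons_of_mem _ hI₁) I₂ (List.mem_cons_of_mem _ hI₂) h12 i j) h2
    refine ⟨fun I' hI' i j => ?_, fun I' hI' i j hij => ?_, fun _ i j hij => ?_⟩
    · rcases List.mem_cons.1 hI' with rfl | hI'
      · have h5 := h1.abs_pairSub_le (x := Fin.castAdd b i) (y := Fin.natAdd b j) fun h => by
          have := congrArg Fin.val h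
          simp at this
          omega
        simp only [pairIdx_castAdd, pairIdx_natAdd] at h5
        have h6 : 0 ≤ b * ((c + b * a) * K) * δ := by positivity
        linarith
      · have h5 := h1.abs_entry_le (hne I' hI').1 (hne I' hI').2 i
          (hinter I' (List.mem_cons_of_mem _ hI') I List.mem_cons_self (hne I' hI').1 i)
          (h3 I' hI' i) j
        calc _ ≤ _ := h5
          _ = b * ((c + b * a) * K) * δ := by ring
          _ ≤ _ := by linarith
    · rcases List.mem_cons.1 hI' with rfl | hI'
      · simpa only [pairIdx_castAdd] using h1.abs_pairSub_le
          (x := Fin.castAdd b i) (y := Fin.castAdd b j) (by simpa)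
      · rw [← heq I' hI' I' hI']
        exact h4 I' hI' i j hij
    · simpa only [pairIdx_natAdd] using h1.abs_pairSub_le
        (x := Fin.natAdd b i) (y := Fin.natAdd b j) (by simpa)

/-- The pairs of the columns `J` in a list, in column-cyclic order. -/
def columns {p : ℕ} (Js : List (Fin p)) : List (Fin p × Fin p) :=
  Js.flatMap fun J => ((List.finRange p).filter fun I => I < J).map fun I => (I, J)

/-- If all pivot submatrices in the first `t` block columns are small when they are treated, then
the leading `t` block rows and columns are small afterwards. -/
lemma abs_entry_le_of_columns (hb : 0 < b) (hdvd : b ∣ n) (hK : 0 ≤ K) (hρ0 : 0 ≤ ρ)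
    (hρ1 : ρ < 1) (t : ℕ) (ht : t ≤ n / b) : ∃ a : ℝ, 0 ≤ a ∧
    ∀ (δ : ℝ) (A B : Matrix (Fin n) (Fin n) ℝ), 0 ≤ δ → A.IsSymm →
      Chain (SmallStep K ρ δ) (columns ((List.finRange (n / b)).take t)) A B →
      ∀ r s : Fin n, (r : ℕ) / b < t → (s : ℕ) / b < t → r ≠ s →
        (2 ≤ t ∨ (r : ℕ) / b ≠ (s : ℕ) / b) → |B r s| ≤ a * δ := by
  induction t with
  | zero => exact ⟨0, le_rfl, fun δ A B _ _ _ r s hr => absurd hr (Nat.not_lt_zero _)⟩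
  | succ t ih =>
    obtain ⟨a, ha, hlead⟩ := ih (by omega)
    set J : Fin (n / b) := ⟨t, by omega⟩ with hJ
    set l := (List.finRange (n / b)).filter fun I => I < J with hl
    have hmem : ∀ I, I ∈ l ↔ I < J := fun I => by simp [hl]
    have hcols : columns ((List.finRange (n / b)).take (t + 1))
        = columns ((List.finRange (n / b)).take t) ++ l.map fun I => (I, J) := by
      rw [columns, List.take_add_one, List.flatMap_append,
        List.getElem?_eq_getElem (by simpa using ht)]
      simp [columns, hl, hJ]
    obtain ⟨c, hc, hcol⟩ := abs_entry_le_of_column (n := n) hK ha ρ J l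
      ((List.nodup_finRange _).filter _) (by simp [hmem])
    -- At the start of the column each relevant entry is at most aδ, cδ or δ; the factor n passes
    -- from entries to the norm, which survives the column.
    refine ⟨n * (a + c + 1), by positivity, fun δ A B hδ hA h r s hr hs hrs hor => ?_⟩
    rw [hcols] at h
    obtain ⟨C, h1, h2⟩ := chain_append.1 h
    have hC : C.IsSymm := (offSq_le_of_chain hρ0 hρ1 (S := Finset.univ) hA
      (chain_jacobiStep_of_smallStep h1) fun _ _ _ => Finset.mem_univ _).1
    -- A single leading block has met no pivot, so nothing bounds its inner entries; `hor` excludes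
    -- exactly this case.
    have ht1 : 1 ≤ t := by
      generalize (r : ℕ) / b = x at hr hor
      generalize (s : ℕ) / b = y at hs hor
      omega
    have hinter : ∀ I₁ ∈ l, ∀ I₂ ∈ l, I₁ ≠ I₂ → ∀ i j,
        |C (blockIdx n b I₁ i) (blockIdx n b I₂ j)| ≤ a * δ := fun I₁ hI₁ I₂ hI₂ h12 i j => by
      have h3 : (I₁ : ℕ) < t := (hmem I₁).1 hI₁
      have h4 : (I₂ : ℕ) < t := (hmem I₂).1 hI₂
      refine hlead δ A C hδ hA h1 _ _ ?_ ?_ ?_ (Or.inr ?_)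
      · rwa [blockIdx_div]
      · rwa [blockIdx_div]
      · rw [Ne, blockIdx_inj]
        exact fun h => h12 h.1
      · rw [blockIdx_div, blockIdx_div]
        exact fun h => h12 (Fin.ext h)
    obtain ⟨h3, h4, h5⟩ := hcol δ C B hδ hC hinter h2
    have hl0 : l ≠ [] := List.ne_nil_of_mem ((hmem ⟨0, by omega⟩).2 (Fin.mk_lt_mk.2 ht1))
    set S : Finset (Fin n) := Finset.univ.filter fun r => (r : ℕ) / b < t + 1 with hS
    have hCS : offSq S C ≤ (n * ((a + c + 1) * δ)) ^ 2 := by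
      refine offSq_le_of_abs_entry_le fun r hr s hs hrs => ?_
      obtain ⟨I, i, rfl⟩ := exists_blockIdx_eq hb hdvd r
      obtain ⟨I', i', rfl⟩ := exists_blockIdx_eq hb hdvd s
      simp only [hS, Finset.mem_filter, Finset.mem_univ, true_and, blockIdx_div] at hr hs
      have key : ∀ I : Fin (n / b), (I : ℕ) < t + 1 → I ∈ l ∨ I = J := fun I hI => by
        rcases Nat.lt_succ_iff_lt_or_eq.1 hI with h | h
        · exact Or.inl ((hmem I).2 h)
        · exact Or.inr (Fin.ext h)
      have ha' : 0 ≤ a * δ := by positivity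
      have hc' : 0 ≤ c * δ := by positivity
      have hsum : (a + c + 1) * δ = a * δ + c * δ + δ := by ring
      rw [hsum]
      rw [Ne, blockIdx_inj, not_and] at hrs
      rcases key I hr with hI | rfl <;> rcases key I' hs with hI' | rfl
      · by_cases h : I = I'
        · subst h
          linarith [h4 I hI i i' (hrs rfl)]
        · linarith [hinter I hI I' hI' h i i']
      · linarith [h3 I hI i i']
      · rw [← hC.apply]
        linarith [h3 I' hI' i' i]
      · linarith [h5 hl0 i i' (hrs rfl)]
    -- All pivots of this column lie in S, so the steps cannot increase the off-diagonal sum over S.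
    have hBS : offSq S B ≤ offSq S C := by
      refine (offSq_le_of_chain hρ0 hρ1 hC (chain_jacobiStep_of_smallStep h2) ?_).2
      intro IJ hIJ x
      obtain ⟨I, hI, rfl⟩ := List.mem_map.1 hIJ
      have hI' : (I : ℕ) < t := (hmem I).1 hI
      simp only [hS, Finset.mem_filter, Finset.mem_univ, true_and]
      rcases pairIdx_div I J x with h | h <;> rw [h]
      · omega
      · simp [hJ]
    rw [mul_assoc]
    exact abs_entry_le_of_offSq_le (by positivity) (hBS.trans hCS)
      (by simpa [hS] using hr) (by simpa [hS] using hs) hrs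

/-- One column-cyclic sweep of Jacobi steps contracts the off-diagonal norm, at a rate that depends
only on the sizes and on the bounds for the steps. -/
lemma exists_sweep_contraction (hb : 0 < b) (hdvd : b ∣ n) (hp : 2 ≤ n / b) (hK : 0 ≤ K)
    (hρ0 : 0 ≤ ρ) (hρ1 : ρ < 1) : ∃ c : ℝ, 0 ≤ c ∧ c < 1 ∧
    ∀ A B : Matrix (Fin n) (Fin n) ℝ, A.IsSymm →
      Chain (JacobiStep K ρ) (columnCyclic (n / b)) A B → offNorm B ≤ c * offNorm A := by
  obtain ⟨a, ha, hall⟩ := abs_entry_le_of_columns (n := n) hb hdvd hK hρ0 hρ1 (n / b) le_rfl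
  have hρ : 0 < 1 - ρ ^ 2 := by nlinarith
  -- With δ chosen below so that (1 - ρ²) δ² is the total loss, the bound (n a δ)² for the final sum
  -- becomes M times the loss. Solving x' ≤ M (x - x') gives x' ≤ M/(1 + M) x.
  set M := (n * a) ^ 2 / (1 - ρ ^ 2) with hM
  have hM0 : 0 ≤ M := by positivity
  refine ⟨Real.sqrt (M / (1 + M)), Real.sqrt_nonneg _, ?_, fun A B hA h => ?_⟩
  · rw [Real.sqrt_lt' one_pos, one_pow, div_lt_one (by positivity)]
    linarith
  have hBA := (offSq_le_of_chain hρ0 hρ1 (S := Finset.univ) hA h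
    fun _ _ _ => Finset.mem_univ _).2
  have hdiff : 0 ≤ (offSq Finset.univ A - offSq Finset.univ B) / (1 - ρ ^ 2) :=
    div_nonneg (by linarith) hρ.le
  set δ := Real.sqrt ((offSq Finset.univ A - offSq Finset.univ B) / (1 - ρ ^ 2)) with hδ
  have hδ2 : δ ^ 2 = (offSq Finset.univ A - offSq Finset.univ B) / (1 - ρ ^ 2) :=
    Real.sq_sqrt hdiff
  have hδ0 : 0 ≤ δ := Real.sqrt_nonneg _
  have hsmall := chain_smallStep_of_offSq_sub_le hρ0 hρ1 hδ0 hA h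
    (by rw [hδ2, mul_div_cancel₀ _ hρ.ne'])
  have htake : columns ((List.finRange (n / b)).take (n / b)) = columnCyclic (n / b) := by
    rw [List.take_of_length_le (by simp), columns, columnCyclic]
  have hlt : ∀ r : Fin n, (r : ℕ) / b < n / b := fun r =>
    Nat.div_lt_div_of_lt_of_dvd hdvd r.isLt
  have hB := offSq_le_of_abs_entry_le (S := Finset.univ) (A := B) (β := a * δ)
    fun r _ s _ hrs => hall δ A B hδ0 hA (htake ▸ hsmall) r s (hlt r) (hlt s) hrs (Or.inl hp)
  have hB' : offSq Finset.univ B ≤ M * (offSq Finset.univ A - offSq Finset.univ B) := by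
    calc _ ≤ _ := hB
      _ = (n * a) ^ 2 * δ ^ 2 := by ring
      _ = _ := by rw [hδ2, hM]; ring
  refine (pow_le_pow_iff_left₀ (offNorm_nonneg _)
    (mul_nonneg (Real.sqrt_nonneg _) (offNorm_nonneg _)) two_ne_zero).1 ?_
  rw [mul_pow, Real.sq_sqrt (by positivity), offNorm_sq, offNorm_sq, div_mul_eq_mul_div,
    le_div_iff₀ (by positivity)]
  linarith

end Blocks

/-! ### From the algorithm's block steps to Jacobi sweeps -/

/-- Every symmetric input can be treated, and every possible result `(Q, D)` is an orthogonal
similarity transformation that shrinks the off-diagonal norm by the factor `ρ`. -/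
def Contracts {m : ℕ} (ρ : ℝ)
    (Sub : Matrix (Fin m) (Fin m) ℝ → Matrix (Fin m) (Fin m) ℝ → Matrix (Fin m) (Fin m) ℝ → Prop) :
    Prop :=
  ∀ A, A.IsSymm → (∃ Q D, Sub A Q D) ∧ ∀ Q D, Sub A Q D →
    Q.transpose * Q = 1 ∧ D = Q.transpose * A * Q ∧ offNorm D ≤ ρ * offNorm A

/-- `T` arises from `S` by an orthogonal similarity transformation that is accumulated in the first
component. -/
def Transforms {n : ℕ} (S T : State n) : Prop :=
  ∃ G : Matrix (Fin n) (Fin n) ℝ, G.transpose * G = 1 ∧ T = (S.1 * G, G.transpose * S.2 * G)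

section

variable {n : ℕ}

lemma Transforms.refl (S : State n) : Transforms S S :=
  ⟨1, by simp, by simp⟩

lemma Transforms.trans {S T W : State n} (h : Transforms S T) (h' : Transforms T W) :
    Transforms S W := by
  obtain ⟨G, hG, rfl⟩ := h
  obtain ⟨H, hH, rfl⟩ := h'
  refine ⟨G * H, ?_, ?_⟩
  · rw [Matrix.transpose_mul, Matrix.mul_assoc, ← Matrix.mul_assoc G.transpose, hG,
      Matrix.one_mul, hH]
  · simp only [Matrix.transpose_mul, Matrix.mul_assoc]

lemma Transforms.isSymm {S T : State n} (h : Transforms S T) (hS : S.2.IsSymm) :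
    T.2.IsSymm := by
  obtain ⟨G, -, rfl⟩ := h
  exact isSymm_conj hS G

variable {b : ℕ} {ρ K : ℝ}
  {Sub : Matrix (Fin (b + b)) (Fin (b + b)) ℝ → Matrix (Fin (b + b)) (Fin (b + b)) ℝ →
    Matrix (Fin (b + b)) (Fin (b + b)) ℝ → Prop}

lemma boundedBlock_one (hK : 1 ≤ K) : BoundedBlock (b := b) K 1 := by
  refine ⟨1, ?_, fun i j => ?_⟩
  · rw [Matrix.submatrix_one _ (Fin.natAdd_injective b b), Matrix.one_mul]
  · rw [Matrix.one_apply]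
    split_ifs
    · simpa using hK
    · simpa using zero_le_one.trans hK

lemma exists_blockStep (hSub : Contracts ρ Sub) (IJ : Fin (n / b) × Fin (n / b)) {S : State n}
    (hS : S.2.IsSymm) : ∃ T, BlockStep b Sub IJ S T := by
  obtain ⟨Q, D, hQD⟩ := (hSub (pairSub S.2 IJ) (hS.submatrix _)).1
  obtain ⟨σ, L, U, h⟩ := exists_isLUPP b (b + b) (by omega)
    (Q.submatrix (Fin.castAdd b) id).transpose
  exact ⟨_, Or.inr ⟨Q, D, σ, L, U, _, hQD, h, rfl, rfl⟩⟩

/-- A skipped pair counts as a step with R = 1, since its pivot submatrix already has off-diagonal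
norm 0. Otherwise pivoting merely permutes rows and columns of D̂ simultaneously, so the contraction
of the recursive call is retained. -/
lemma BlockStep.jacobiStep (hSub : Contracts ρ Sub) (hK1 : 1 ≤ K)
    (hK : ∀ (Q : Matrix (Fin (b + b)) (Fin (b + b)) ℝ) (σ : Equiv.Perm (Fin (b + b)))
      (L : Matrix (Fin (b + b)) (Fin b) ℝ) (U : Matrix (Fin b) (Fin b) ℝ),
      Q.transpose * Q = 1 → IsLUPP (Q.submatrix (Fin.castAdd b) id).transpose σ L U →
      BoundedBlock K (Q * (σ.permMatrix ℝ).transpose))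
    {IJ : Fin (n / b) × Fin (n / b)} (hIJ : IJ.1 < IJ.2) {S T : State n} (hS : S.2.IsSymm)
    (h : BlockStep b Sub IJ S T) : Transforms S T ∧ JacobiStep K ρ IJ S.2 T.2 := by
  rcases h with ⟨hdiag, rfl⟩ | ⟨Q, D, σ, L, U, G, hQD, hLU, rfl, rfl⟩
  · refine ⟨Transforms.refl _, hIJ, 1, by simp, boundedBlock_one hK1, ?_, ?_⟩
    · simp [pairSub, offNorm_eq_zero_of_isDiag hdiag]
    · simp [embed_one]
  · obtain ⟨hQ, hD, hρ⟩ := (hSub (pairSub S.2 IJ) (hS.submatrix _)).2 Q D hQD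
    have hR := orthogonal_mul_permMatrix hQ σ
    refine ⟨⟨_, embed_orthogonal (pairIdx_injective hIJ.ne) hR, rfl⟩, hIJ, _, hR,
      hK Q σ L U hQ hLU, ?_, rfl⟩
    refine le_of_eq_of_le ?_ hρ
    rw [← offNorm_submatrix_perm D σ]
    congr 1
    rw [hD, Matrix.transpose_mul, Matrix.transpose_transpose]
    have h1 : σ.permMatrix ℝ * Q.transpose * pairSub S.2 IJ * (Q * (σ.permMatrix ℝ).transpose)
        = σ.permMatrix ℝ * (Q.transpose * pairSub S.2 IJ * Q) * (σ.permMatrix ℝ).transpose := by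
      simp only [Matrix.mul_assoc]
    rw [h1, Matrix.transpose_permMatrix, PEquiv.toMatrix_toPEquiv_mul,
      PEquiv.mul_toMatrix_toPEquiv]
    rfl

lemma exists_blockSteps (hSub : Contracts ρ Sub) (l : List (Fin (n / b) × Fin (n / b)))
    (hl : ∀ IJ ∈ l, IJ.1 < IJ.2) {S : State n} (hS : S.2.IsSymm) :
    ∃ T, BlockSteps b Sub l S T := by
  obtain ⟨K, hK1, hK⟩ := exists_boundedBlock_of_isLUPP b
  induction l generalizing S with
  | nil => exact ⟨S, rfl⟩
  | cons IJ l ih =>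
    obtain ⟨S', h⟩ := exists_blockStep hSub IJ hS
    have hS' := (h.jacobiStep hSub hK1 hK (hl IJ List.mem_cons_self) hS).1.isSymm hS
    obtain ⟨T, hT⟩ := ih (fun IJ hIJ => hl IJ (List.mem_cons_of_mem _ hIJ)) hS'
    exact ⟨T, S', h, hT⟩

lemma blockSteps_transforms_and_chain (hSub : Contracts ρ Sub) (hK1 : 1 ≤ K)
    (hK : ∀ (Q : Matrix (Fin (b + b)) (Fin (b + b)) ℝ) (σ : Equiv.Perm (Fin (b + b)))
      (L : Matrix (Fin (b + b)) (Fin b) ℝ) (U : Matrix (Fin b) (Fin b) ℝ),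
      Q.transpose * Q = 1 → IsLUPP (Q.submatrix (Fin.castAdd b) id).transpose σ L U →
      BoundedBlock K (Q * (σ.permMatrix ℝ).transpose))
    {l : List (Fin (n / b) × Fin (n / b))} (hl : ∀ IJ ∈ l, IJ.1 < IJ.2) {S T : State n}
    (hS : S.2.IsSymm) (h : BlockSteps b Sub l S T) :
    Transforms S T ∧ Chain (JacobiStep K ρ) l S.2 T.2 := by
  induction l generalizing S with
  | nil =>
    obtain rfl : T = S := h
    exact ⟨Transforms.refl _, rfl⟩
  | cons IJ l ih =>
    obtain ⟨S', h1, h2⟩ := h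
    obtain ⟨h3, h4⟩ := h1.jacobiStep hSub hK1 hK (hl IJ List.mem_cons_self) hS
    obtain ⟨h5, h6⟩ := ih (fun IJ hIJ => hl IJ (List.mem_cons_of_mem _ hIJ)) (h3.isSymm hS) h2
    exact ⟨h3.trans h5, S'.2, h4, h6⟩

end

lemma lt_of_mem_columnCyclic {p : ℕ} {IJ : Fin p × Fin p} (h : IJ ∈ columnCyclic p) :
    IJ.1 < IJ.2 := by
  obtain ⟨J, -, hJ⟩ := List.mem_flatMap.1 h
  obtain ⟨I, hI, rfl⟩ := List.mem_map.1 hJ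
  simpa using hI

variable {P : Params} {n : ℕ}

lemma exists_sweep {ρ : ℝ}
    (hrec : Contracts ρ (Call P (P.blockSize n + P.blockSize n)))
    {S : State n} (hS : S.2.IsSymm) : ∃ T, Sweep P n S T :=
  exists_blockSteps hrec _ (fun _ => lt_of_mem_columnCyclic) hS

/-- If the recursive calls contract the off-diagonal norm, then so do the sweeps. -/
lemma exists_contraction_of_recursive_calls (hbase : ¬ P.IsBase n) (hpos : 0 < P.blockSize n)
    (hdvd : P.blockSize n ∣ n) {ρ : ℝ} (hρ0 : 0 ≤ ρ) (hρ1 : ρ < 1)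
    (hrec : Contracts ρ (Call P (P.blockSize n + P.blockSize n))) :
    ∃ c : ℝ, 0 ≤ c ∧ c < 1 ∧ ∀ S T : State n, S.2.IsSymm → Sweep P n S T →
      Transforms S T ∧ offNorm T.2 ≤ c * offNorm S.2 := by
  obtain ⟨K, hK1, hK⟩ := exists_boundedBlock_of_isLUPP (P.blockSize n)
  have hp : 2 ≤ n / P.blockSize n := by
    rw [Nat.le_div_iff_mul_le hpos]
    simp only [Params.IsBase, not_or, not_le] at hbase
    omega
  obtain ⟨c, hc0, hc1, hc⟩ := exists_sweep_contraction (n := n) hpos hdvd hp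
    (zero_le_one.trans hK1) hρ0 hρ1
  refine ⟨c, hc0, hc1, fun S T hS h => ?_⟩
  obtain ⟨h1, h2⟩ := blockSteps_transforms_and_chain hrec hK1 hK
    (fun _ => lt_of_mem_columnCyclic) hS h
  exact ⟨h1, hc _ _ hS h2⟩

/-- After `k` contracting sweeps the off-diagonal norm has decreased by the factor `c ^ k`. -/
lemma transforms_and_offNorm_le_of_run {c : ℝ} (hc0 : 0 ≤ c)
    (hc : ∀ S T : State n, S.2.IsSymm → Sweep P n S T →
      Transforms S T ∧ offNorm T.2 ≤ c * offNorm S.2)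
    {run : ℕ → State n} (h0 : (run 0).2.IsSymm) (k : ℕ)
    (hrun : ∀ s < k, Sweep P n (run s) (run (s + 1))) :
    Transforms (run 0) (run k) ∧ offNorm (run k).2 ≤ c ^ k * offNorm (run 0).2 := by
  induction k with
  | zero => exact ⟨Transforms.refl _, by simp⟩
  | succ k ih =>
    obtain ⟨h1, h2⟩ := ih fun s hs => hrun s (hs.trans k.lt_succ_self)
    obtain ⟨h3, h4⟩ := hc _ _ (h1.isSymm h0) (hrun k k.lt_succ_self)
    refine ⟨h1.trans h3, h4.trans ?_⟩
    rw [pow_succ', mul_assoc]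
    gcongr

lemma tendsto_offNorm_of_run {c : ℝ} (hc0 : 0 ≤ c) (hc1 : c < 1)
    (hc : ∀ S T : State n, S.2.IsSymm → Sweep P n S T →
      Transforms S T ∧ offNorm T.2 ≤ c * offNorm S.2)
    {run : ℕ → State n} (h0 : (run 0).2.IsSymm)
    (hrun : ∀ s, Sweep P n (run s) (run (s + 1))) :
    Tendsto (fun s => offNorm (run s).2) atTop (𝓝 0) := by
  refine squeeze_zero (fun s => offNorm_nonneg _)
    (fun s => (transforms_and_offNorm_le_of_run hc0 hc h0 s fun t _ => hrun t).2) ?_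
  simpa using (tendsto_pow_atTop_nhds_zero_of_lt_one hc0 hc1).mul_const (offNorm (run 0).2)

/-! ### Termination and contraction of recursive calls -/

lemma call_of_isBase (h : P.IsBase n) (A Q D : Matrix (Fin n) (Fin n) ℝ) :
    Call P n A Q D ↔ IsEigendecomposition A Q D := by
  rw [Call, dif_pos h]

lemma call_of_not_isBase (h : ¬ P.IsBase n) (A Q D : Matrix (Fin n) (Fin n) ℝ) :
    Call P n A Q D ↔ ∃ (k : ℕ) (run : ℕ → State n), 0 < k ∧ run 0 = (1, A) ∧
      (∀ s < k, Sweep P n (run s) (run (s + 1))) ∧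
      (∀ s, 0 < s → s < k → ¬ OffEntriesLE (P.tol n A) (run s).2) ∧
      OffEntriesLE (P.tol n A) (run k).2 ∧ run k = (Q, D) := by
  rw [Call, dif_neg h]
  rfl

lemma contracts_call_of_isBase (h : P.IsBase n) : Contracts 0 (Call P n) := by
  intro A hA
  simp only [call_of_isBase h]
  refine ⟨exists_isEigendecomposition hA, fun Q D ⟨hQ, hD, hAQ⟩ => ⟨hQ, ?_, ?_⟩⟩
  · rw [hAQ]
    calc D = (Q.transpose * Q) * D * (Q.transpose * Q) := by
          rw [hQ, Matrix.one_mul, Matrix.mul_one]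
      _ = _ := by simp only [Matrix.mul_assoc]
  · rw [offNorm_eq_zero_of_isDiag hD, zero_mul]

/-- Contracting sweeps push the off-diagonal norm below the positive tolerance, so a first stopping
time exists. The rate c is already reached by the one sweep that every call makes. -/
lemma contracts_call_of_sweeps (htol : ∀ B, 0 < P.tol n B) (hbase : ¬ P.IsBase n)
    (hex : ∀ S : State n, S.2.IsSymm → ∃ T, Sweep P n S T)
    {c : ℝ} (hc0 : 0 ≤ c) (hc1 : c < 1)
    (hc : ∀ S T : State n, S.2.IsSymm → Sweep P n S T →
      Transforms S T ∧ offNorm T.2 ≤ c * offNorm S.2) : Contracts c (Call P n) := by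
  classical
  intro A hA
  simp only [call_of_not_isBase hbase]
  constructor
  · choose f hf using hex
    -- The default branch is never taken: symmetry is preserved from `(1, A)` on.
    let next : State n → State n := fun S => if h : S.2.IsSymm then f S h else S
    let run : ℕ → State n := fun s => next^[s] (1, A)
    have hstep : ∀ s, (run s).2.IsSymm ∧ Sweep P n (run s) (run (s + 1)) := by
      have hnext : ∀ s, (run s).2.IsSymm → Sweep P n (run s) (run (s + 1)) := fun s hs => by
        have : run (s + 1) = f (run s) hs := by
          simp only [run, Function.iterate_succ_apply']
          exact dif_pos hs
        rw [this]
        exact hf _ hs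
      intro s
      induction s with
      | zero => exact ⟨hA, hnext 0 hA⟩
      | succ s ih =>
        have := (hc _ _ ih.1 ih.2).1.isSymm ih.1
        exact ⟨this, hnext _ this⟩
    have hlim := tendsto_offNorm_of_run hc0 hc1 hc (run := run) hA fun s => (hstep s).2
    have hsmall : ∃ k, 0 < k ∧ OffEntriesLE (P.tol n A) (run k).2 := by
      obtain ⟨k, hk, hk0⟩ :=
        ((hlim.eventually (gt_mem_nhds (htol A))).and (eventually_gt_atTop 0)).exists
      exact ⟨k, hk0, fun i j hij => (abs_entry_le_offNorm _ hij).trans hk.le⟩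
    refine ⟨(run (Nat.find hsmall)).1, (run (Nat.find hsmall)).2, Nat.find hsmall, run,
      (Nat.find_spec hsmall).1, rfl, fun s _ => (hstep s).2, fun s hs0 hs hle => ?_,
      (Nat.find_spec hsmall).2, rfl⟩
    exact Nat.find_min hsmall hs ⟨hs0, hle⟩
  · rintro Q D ⟨k, run, hk, h0, hrun, -, -, hkQ⟩
    have h0A : (run 0).2.IsSymm := by rw [h0]; exact hA
    obtain ⟨⟨G, hG, hT⟩, hle⟩ := transforms_and_offNorm_le_of_run hc0 hc h0A k hrun
    rw [hkQ, h0] at hT hle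
    simp only [Matrix.one_mul, Prod.mk.injEq] at hT
    obtain ⟨rfl, rfl⟩ := hT
    refine ⟨hG, rfl, hle.trans ?_⟩
    -- Since k ≥ 1, c ^ k ≤ c; without a compulsory first sweep the factor could be 1.
    exact mul_le_mul_of_nonneg_right (pow_le_of_le_one hc0 hc1.le hk.ne') (offNorm_nonneg _)

/-- Recursive calls return, and they contract the off-diagonal norm. -/
lemma exists_contracts_call (htol : ∀ (m : ℕ) (B : Matrix (Fin m) (Fin m) ℝ), 0 < P.tol m B)
    (hn : P.Admissible n) : ∃ ρ : ℝ, 0 ≤ ρ ∧ ρ < 1 ∧ Contracts ρ (Call P n) := by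
  induction hn with
  | base n h => exact ⟨0, le_rfl, one_pos, contracts_call_of_isBase h⟩
  | split n h hpos hdvd _ ih =>
    obtain ⟨ρ, hρ0, hρ1, hrec⟩ := ih
    obtain ⟨c, hc0, hc1, hc⟩ :=
      exists_contraction_of_recursive_calls h hpos hdvd hρ0 hρ1 hrec
    exact ⟨c, hc0, hc1,
      contracts_call_of_sweeps (htol n) h (fun _ => exists_sweep hrec) hc0 hc1 hc⟩

end RecJacobi

theorem mainTheorem5 (P : RecJacobi.Params)
    (htol : ∀ (m : ℕ) (B : Matrix (Fin m) (Fin m) ℝ), 0 < P.tol m B)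
    (n : ℕ) (hn : P.Admissible n)
    (A : Matrix (Fin n) (Fin n) ℝ) (hA : A.IsSymm) :
    -- the call on `A` can be carried out and returns
    (∃ Q D, RecJacobi.Call P n A Q D) ∧
    -- in the base case the returned matrix is diagonal
    (P.IsBase n → ∀ Q D, RecJacobi.Call P n A Q D → RecJacobi.offNorm D = 0) ∧
    -- otherwise, sweeping never gets stuck (the recursive calls return) ...
    (¬ P.IsBase n →
      (∀ (k : ℕ) (run : ℕ → RecJacobi.State n), run 0 = (1, A) →
        (∀ s < k, RecJacobi.Sweep P n (run s) (run (s + 1))) →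
        ∃ T, RecJacobi.Sweep P n (run k) T) ∧
      -- ... and the off-diagonal norm tends to zero along every infinite sequence of sweeps
      (∀ run : ℕ → RecJacobi.State n, run 0 = (1, A) →
        (∀ s, RecJacobi.Sweep P n (run s) (run (s + 1))) →
        Tendsto (fun s => RecJacobi.offNorm (run s).2) atTop (𝓝 0))) := by

  obtain ⟨_, -, -, hcall⟩ := RecJacobi.exists_contracts_call htol hn
  refine ⟨(hcall A hA).1, fun hbase Q D h => ?_, fun hbase => ?_⟩
  · exact RecJacobi.offNorm_eq_zero_of_isDiag ((RecJacobi.call_of_isBase hbase A Q D).1 h).2.1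
  · rcases hn with ⟨_, h⟩ | ⟨_, _, hpos, hdvd, hrec⟩
    · exact absurd h hbase
    -- Contraction of the whole call does not control its single sweeps; these need the contraction
    -- at the subproblem size.
    obtain ⟨ρ, hρ0, hρ1, hsub⟩ := RecJacobi.exists_contracts_call htol hrec
    obtain ⟨c, hc0, hc1, hc⟩ :=
      RecJacobi.exists_contraction_of_recursive_calls hbase hpos hdvd hρ0 hρ1 hsub
    have hsymm : ∀ run : ℕ → RecJacobi.State n, run 0 = (1, A) → (run 0).2.IsSymm :=
      fun run h0 => by rw [h0]; exact hA
    refine ⟨fun k run h0 hrun => ?_, fun run h0 hrun => ?_⟩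
    · exact RecJacobi.exists_sweep hsub ((RecJacobi.transforms_and_offNorm_le_of_run hc0 hc
        (hsymm run h0) k hrun).1.isSymm (hsymm run h0))
    · exact RecJacobi.tendsto_offNorm_of_run hc0 hc1 hc (hsymm run h0) hrun
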